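/- For a topological space $Y$, let $\mathcal M_\tau(Y)$ be the set of $\tau$-additive Borel probability measures on $Y$, where $\mu$ is $\tau$-additive if $\mu(\bigcup\mathcal G)=\sup_{U\in\mathcal G}\mu(U)$ for every nonempty upwards directed family $\mathcal G$ of open sets. For topological spaces $Y,Z$, $\mu\in\mathcal M_\tau(Y)$ and $\nu\in\mathcal M_\tau(Z)$, let $\mu\times\nu$ be the $\tau$-additive product, i.e. the unique $\tau$-additive probability measure on the Borel $\sigma$-algebra of the product topology on $Y\times Z$ such that $(\mu\times\nu)(U\times V)=\mu(U)\,\nu(V)$ for all open $U\subseteq Y$, $V\subseteq Z$. Let a topological group $G$ act on a regular topological space $X$ (Hausdorffness is not assumed) by a jointly continuous action $G\times X\to X$, $(g,x)\mapsto g\cdot x$. Let $\mu\in\mathcal M_\tau(G)$ and $\nu\in\mathcal M_\tau(X)$, and let $\mu*\nu$ be the Borel measure on $X$ defined by $$(\mu*\nu)(E)=(\mu\times\nu)\big(\{(g,x)\in G\times X : g\cdot x\in E\}\big)\qquad\text{for Borel } E\subseteq X .$$ Let $f:X\to\mathbb R$ be $(\mu*\nu)$-integrable. Then $(g,x)\mapsto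 f(g\cdot x)$ is $(\mu\times\nu)$-integrable; for $\nu$-almost every $x$ the function $g\mapsto f(g\cdot x)$ is $\mu$-integrable, and the ($\nu$-a.e. defined) function $x\mapsto\int f(g\cdot x)\,d\mu(g)$ is $\nu$-integrable; for $\mu$-almost every $g$ the function $x\mapsto f(g\cdot x)$ is $\nu$-integrable, and the ($\mu$-a.e. defined) function $g\mapsto\int f(g\cdot x)\,d\nu(x)$ is $\mu$-integrable; and $$\int f\,d(\mu*\nu)=\int f(g\cdot x)\,d(\mu\times\nu)(g,x)=\int\!\!\int f(g\cdot x)\,d\mu(g)\,d\nu(x)=\int\!\!\int f(g\cdot x)\,d\nu(x)\,d\mu(g).$$ -/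

import Mathlib

open MeasureTheory Set

/-- Measures on the Borel `σ`-algebra of a topological space. On a product `X × Y` this is the
Borel `σ`-algebra of the product topology, which may be strictly larger than the product
`σ`-algebra that is Mathlib's default instance on `X × Y`. -/
abbrev BorelMeasure (X : Type*) [TopologicalSpace X] : Type _ := @Measure X (borel X)

/-- `τ`-additivity of a Borel measure: for each nonempty upwards directed family of open sets, the
measure of the union is the supremum of the measures. -/
def TauAdditive {X : Type*} [TopologicalSpace X] (μ : BorelMeasure X) : Prop :=
  ∀ 𝒢 : Set (Set X), 𝒢.Nonempty → DirectedOn (· ⊆ ·) 𝒢 → (∀ U ∈ 𝒢, IsOpen U) →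
    μ (⋃₀ 𝒢) = ⨆ U ∈ 𝒢, μ U

/-- The set of `τ`-additive Borel probability measures on `X`. -/
def MTau (X : Type*) [TopologicalSpace X] : Set (BorelMeasure X) :=
  {μ | IsProbabilityMeasure μ ∧ TauAdditive μ}

theorem TauAdditive.lowerSemicontinuous_section {X Y : Type*} [TopologicalSpace X]
    [TopologicalSpace Y] {ν : BorelMeasure Y} (hν : TauAdditive ν) {W : Set (X × Y)}
    (hW : IsOpen W) : LowerSemicontinuous fun x => ν (Prod.mk x ⁻¹' W) := by
  intro x₀ c hc
  let 𝒢 : Set (Set Y) := {V | IsOpen V ∧ ∃ U : Set X, IsOpen U ∧ x₀ ∈ U ∧ U ×ˢ V ⊆ W}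
  have hne : 𝒢.Nonempty := ⟨∅, isOpen_empty, univ, isOpen_univ, trivial, by simp⟩
  have hdir : DirectedOn (· ⊆ ·) 𝒢 := by
    rintro V₁ ⟨hV₁, U₁, hU₁, hx₁, h₁⟩ V₂ ⟨hV₂, U₂, hU₂, hx₂, h₂⟩
    refine ⟨V₁ ∪ V₂, ⟨hV₁.union hV₂, U₁ ∩ U₂, hU₁.inter hU₂, ⟨hx₁, hx₂⟩, ?_⟩,
      subset_union_left, subset_union_right⟩
    rintro ⟨x, y⟩ ⟨⟨hx, hx'⟩, hy | hy⟩
    · exact h₁ ⟨hx, hy⟩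
    · exact h₂ ⟨hx', hy⟩
  have hun : ⋃₀ 𝒢 = Prod.mk x₀ ⁻¹' W := by
    ext y
    constructor
    · rintro ⟨V, ⟨_, U, _, hx, h⟩, hy⟩
      exact h ⟨hx, hy⟩
    · intro hy
      obtain ⟨U, V, hU, hV, hx, hy, h⟩ := isOpen_prod_iff.1 hW x₀ y hy
      exact ⟨V, ⟨hV, U, hU, hx, h⟩, hy⟩
  have key := hν 𝒢 hne hdir fun V hV => hV.1
  rw [hun] at key
  simp only at hc
  rw [key] at hc
  obtain ⟨V, hV⟩ := lt_iSup_iff.1 hc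
  obtain ⟨⟨_, U, hU, hx, h⟩, hlt⟩ := lt_iSup_iff.1 hV
  filter_upwards [hU.mem_nhds hx] with x hxU
  exact hlt.trans_le (measure_mono fun y hy => h ⟨hxU, hy⟩)

theorem measurable_section_of_mem_MTau {X Y : Type*} [TopologicalSpace X] [TopologicalSpace Y]
    {ν : BorelMeasure Y} (hν : ν ∈ MTau Y) {W : Set (X × Y)} (hW : MeasurableSet[borel (X × Y)] W) :
    Measurable[borel X] fun x => ν (Prod.mk x ⁻¹' W) := by
  let _ : MeasurableSpace X := borel X
  have : BorelSpace X := ⟨rfl⟩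
  let _ : MeasurableSpace Y := borel Y
  have : BorelSpace Y := ⟨rfl⟩
  have : IsProbabilityMeasure ν := hν.1
  have hmk : ∀ (x : X) (t : Set (X × Y)), MeasurableSet[borel (X × Y)] t →
      MeasurableSet (Prod.mk x ⁻¹' t) := fun x t ht =>
    (Continuous.borel_measurable (by fun_prop : Continuous (Prod.mk x : Y → X × Y))) ht
  induction W, hW using MeasurableSpace.induction_on_inter
    (rfl : borel (X × Y) = _) isPiSystem_isOpen with
  | empty => simp
  | basic t ht => exact (hν.2.lowerSemicontinuous_section ht).measurable
  | compl t ht ih =>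
    have : (fun x => ν (Prod.mk x ⁻¹' tᶜ)) = fun x => 1 - ν (Prod.mk x ⁻¹' t) := by
      funext x
      rw [preimage_compl, prob_compl_eq_one_sub (hmk x t ht)]
    rw [this]
    exact ih.const_sub 1
  | iUnion f hd hf ih =>
    have : (fun x => ν (Prod.mk x ⁻¹' ⋃ i, f i)) = fun x => ∑' i, ν (Prod.mk x ⁻¹' f i) := by
      funext x
      rw [preimage_iUnion, measure_iUnion]
      · exact fun i j hij => (hd hij).preimage _
      · exact fun i => hmk x _ (hf i)
    rw [this]
    exact Measurable.tsum ih

/-- A directed supremum of lower semicontinuous functions commutes with the integral against a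
`τ`-additive probability measure. -/
theorem lintegral_le_iSup_of_directed {X ι : Type*} [TopologicalSpace X] {μ : BorelMeasure X}
    (hμ : μ ∈ MTau X) [Nonempty ι] [Preorder ι] [IsDirected ι (· ≤ ·)]
    (h : ι → X → ENNReal) (hm : Monotone h) (hl : ∀ i, LowerSemicontinuous (h i)) :
    ∫⁻ x, ⨆ i, h i x ∂μ ≤ ⨆ i, ∫⁻ x, h i x ∂μ := by
  let _ : MeasurableSpace X := borel X
  have : BorelSpace X := ⟨rfl⟩
  have : IsProbabilityMeasure μ := hμ.1
  have hsup : ∀ q : ENNReal, μ {x | q < ⨆ i, h i x} = ⨆ i, μ {x | q < h i x} := by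
    intro q
    have h1 := hμ.2 (range fun i => {x | q < h i x}) (range_nonempty _)
      (by
        rintro _ ⟨i, rfl⟩ _ ⟨j, rfl⟩
        obtain ⟨k, hik, hjk⟩ := exists_ge_ge i j
        exact ⟨_, ⟨k, rfl⟩, fun x (hx : q < h i x) => lt_of_lt_of_le hx (hm hik x),
          fun x (hx : q < h j x) => lt_of_lt_of_le hx (hm hjk x)⟩)
      (by
        rintro _ ⟨i, rfl⟩
        exact (hl i).isOpen_preimage q)
    rw [iSup_range] at h1
    rw [← h1]
    congr 1
    ext x
    simp [lt_iSup_iff]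
  have hex : ∀ p : ℚ × ℕ, ∃ i, μ {x | (Real.toNNReal p.1 : ENNReal) < ⨆ i, h i x} ≤
      μ {x | (Real.toNNReal p.1 : ENNReal) < h i x} + ((p.2 : ENNReal) + 1)⁻¹ := by
    intro p
    rw [hsup]
    by_contra! hc
    obtain ⟨i₀⟩ := ‹Nonempty ι›
    have h0 : ((p.2 : ENNReal) + 1)⁻¹ ≠ 0 := by
      simp [ENNReal.inv_eq_zero]
    have hle : (⨆ i, μ {x | (Real.toNNReal p.1 : ENNReal) < h i x}) + ((p.2 : ENNReal) + 1)⁻¹ ≤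
        ⨆ i, μ {x | (Real.toNNReal p.1 : ENNReal) < h i x} := by
      have : Nonempty ι := ⟨i₀⟩
      rw [ENNReal.iSup_add]
      exact iSup_le fun i => (hc i).le
    have hfin : (⨆ i, μ {x | (Real.toNNReal p.1 : ENNReal) < h i x}) ≠ ⊤ := by
      rw [← hsup]
      exact measure_ne_top _ _
    exact absurd hle (not_le.2 (ENNReal.lt_add_right hfin h0))
  choose c hc using hex
  obtain ⟨e, he⟩ := exists_surjective_nat (ℚ × ℕ)
  choose up hup₁ hup₂ using fun i j : ι => exists_ge_ge i j
  let s : ℕ → ι := fun n => Nat.rec (c (e 0)) (fun k i => up i (c (e k))) n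
  have hs : Monotone s := monotone_nat_of_le_succ fun n => hup₁ _ _
  have hcs : ∀ k, c (e k) ≤ s (k + 1) := fun k => hup₂ _ _
  have hae : ∀ q : ℚ, ∀ᵐ x ∂μ, (Real.toNNReal q : ENNReal) < ⨆ i, h i x →
      (Real.toNNReal q : ENNReal) < ⨆ n, h (s n) x := by
    intro q
    have hmeas : MeasurableSet {x | (Real.toNNReal q : ENNReal) < ⨆ n, h (s n) x} :=
      measurableSet_lt measurable_const (Measurable.iSup fun n => (hl _).measurable)
    have hsub : {x | (Real.toNNReal q : ENNReal) < ⨆ n, h (s n) x} ⊆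
        {x | (Real.toNNReal q : ENNReal) < ⨆ i, h i x} := fun x hx =>
      lt_of_lt_of_le hx (iSup_le fun n => le_iSup (fun i => h i x) (s n))
    have hle : μ {x | (Real.toNNReal q : ENNReal) < ⨆ i, h i x} ≤
        μ {x | (Real.toNNReal q : ENNReal) < ⨆ n, h (s n) x} := by
      have hn : ∀ n : ℕ, μ {x | (Real.toNNReal q : ENNReal) < ⨆ i, h i x} ≤
          μ {x | (Real.toNNReal q : ENNReal) < ⨆ n, h (s n) x} + ((n : ENNReal) + 1)⁻¹ := by
        intro n
        obtain ⟨k, hk⟩ := he (q, n)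
        have := hc (e k)
        rw [hk] at this
        refine this.trans (add_le_add (measure_mono fun x hx => ?_) le_rfl)
        refine lt_of_lt_of_le hx (le_trans ?_ (le_iSup (fun n => h (s n) x) (k + 1)))
        rw [← hk]
        exact hm (hcs k) x
      refine ENNReal.le_of_forall_pos_le_add fun ε hε _ => ?_
      obtain ⟨n, hn'⟩ := ENNReal.exists_inv_nat_lt (ENNReal.coe_pos.2 hε).ne'
      refine (hn n).trans (add_le_add le_rfl (le_trans ?_ hn'.le))
      exact ENNReal.inv_le_inv.2 le_self_add
    have h0 := measure_sdiff hsub hmeas.nullMeasurableSet (measure_ne_top μ _)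
    rw [tsub_eq_zero_of_le hle] at h0
    refine measure_mono_null (fun x hx => ?_) h0
    exact Classical.not_imp.1 hx
  calc ∫⁻ x, ⨆ i, h i x ∂μ ≤ ∫⁻ x, ⨆ n, h (s n) x ∂μ := by
        refine lintegral_mono_ae ?_
        filter_upwards [ae_all_iff.2 hae] with x hx
        refine le_of_forall_lt fun a ha => ?_
        obtain ⟨q, _, haq, hq⟩ := ENNReal.lt_iff_exists_rat_btwn.1 ha
        exact haq.trans (hx q hq)
    _ = ⨆ n, ∫⁻ x, h (s n) x ∂μ :=
        lintegral_iSup (fun n => (hl _).measurable) fun i j hij => hm (hs hij)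
    _ ≤ ⨆ i, ∫⁻ x, h i x ∂μ := iSup_le fun n => le_iSup (fun i => ∫⁻ x, h i x ∂μ) (s n)

/-- The defining property of the `τ`-additive product of `μ` and `ν`: a `τ`-additive probability
measure on the Borel sets of `X × Y` with the product values on open rectangles. -/
def IsTauProd {X Y : Type*} [TopologicalSpace X] [TopologicalSpace Y] (μ : BorelMeasure X)
    (ν : BorelMeasure Y) (l : BorelMeasure (X × Y)) : Prop :=
  l ∈ MTau (X × Y) ∧ ∀ (U : Set X) (V : Set Y), IsOpen U → IsOpen V → l (U ×ˢ V) = μ U * ν V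

theorem exists_isTauProd {X Y : Type*} [TopologicalSpace X] [TopologicalSpace Y]
    {μ : BorelMeasure X} {ν : BorelMeasure Y} (hμ : μ ∈ MTau X) (hν : ν ∈ MTau Y) :
    ∃ l : BorelMeasure (X × Y), IsTauProd μ ν l := by
  let _ : MeasurableSpace X := borel X
  have : BorelSpace X := ⟨rfl⟩
  let _ : MeasurableSpace Y := borel Y
  have : BorelSpace Y := ⟨rfl⟩
  have : IsProbabilityMeasure μ := hμ.1
  have : IsProbabilityMeasure ν := hν.1
  have hmk : ∀ x : X, @Measurable Y (X × Y) _ (borel (X × Y)) (Prod.mk x) := fun x =>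
    Continuous.borel_measurable (by fun_prop)
  let κ : X → BorelMeasure (X × Y) := fun x => @Measure.map Y (X × Y) _ (borel _) (Prod.mk x) ν
  have hκ : ∀ x W, MeasurableSet[borel (X × Y)] W → κ x W = ν (Prod.mk x ⁻¹' W) := fun x W hW =>
    @Measure.map_apply Y (X × Y) _ (borel _) ν _ (hmk x) W hW
  have hκm : Measurable κ := by
    refine @Measure.measurable_of_measurable_coe (X × Y) X (borel _) _ κ fun W hW => ?_
    simp_rw [hκ _ W hW]
    exact measurable_section_of_mem_MTau hν hW
  let l : BorelMeasure (X × Y) := @Measure.bind X (X × Y) _ (borel _) μ κ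
  have hl : ∀ W, MeasurableSet[borel (X × Y)] W → l W = ∫⁻ x, ν (Prod.mk x ⁻¹' W) ∂μ := by
    intro W hW
    have := @Measure.bind_apply X (X × Y) _ (borel _) μ κ W hW hκm.aemeasurable
    simp_rw [hκ _ W hW] at this
    exact this
  have hopen : ∀ W : Set (X × Y), IsOpen W → MeasurableSet[borel (X × Y)] W := fun W hW =>
    MeasurableSpace.measurableSet_generateFrom hW
  refine ⟨l, ⟨⟨?_⟩, ?_⟩, ?_⟩
  · rw [hl _ (hopen _ isOpen_univ)]
    simp
  · intro 𝒢 hne hdir ho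
    refine le_antisymm ?_ (iSup₂_le fun U hU => measure_mono (subset_sUnion_of_mem hU))
    have : Nonempty 𝒢 := hne.to_subtype
    have : IsDirected 𝒢 (· ≤ ·) := ⟨fun a b => by
      obtain ⟨c, hc, hac, hbc⟩ := hdir a a.2 b b.2
      exact ⟨⟨c, hc⟩, hac, hbc⟩⟩
    have hsec : ∀ x, ν (Prod.mk x ⁻¹' ⋃₀ 𝒢) = ⨆ W : 𝒢, ν (Prod.mk x ⁻¹' (W : Set (X × Y))) := by
      intro x
      have := hν.2 (range fun W : 𝒢 => Prod.mk x ⁻¹' (W : Set (X × Y))) (range_nonempty _)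
        (by
          rintro _ ⟨i, rfl⟩ _ ⟨j, rfl⟩
          obtain ⟨k, hik, hjk⟩ := exists_ge_ge i j
          exact ⟨_, ⟨k, rfl⟩, preimage_mono hik, preimage_mono hjk⟩)
        (by
          rintro _ ⟨i, rfl⟩
          exact (ho i i.2).preimage (by fun_prop))
      rw [iSup_range] at this
      rw [← this]
      congr 1
      ext y
      simp
    rw [hl _ (hopen _ (isOpen_sUnion ho))]
    simp_rw [hsec]
    refine (lintegral_le_iSup_of_directed hμ (fun (W : 𝒢) x => ν (Prod.mk x ⁻¹' (W : Set (X × Y))))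
      (fun i j hij x => measure_mono (preimage_mono hij))
      fun i => hν.2.lowerSemicontinuous_section (ho i i.2)).trans ?_
    refine iSup_le fun W => ?_
    rw [← hl _ (hopen _ (ho W W.2))]
    exact le_iSup₂ (f := fun U (_ : U ∈ 𝒢) => l U) W.1 W.2
  · intro U V hU hV
    rw [hl _ (hopen _ (hU.prod hV))]
    have : (fun x => ν (Prod.mk x ⁻¹' (U ×ˢ V))) = U.indicator fun _ => ν V := by
      funext x
      by_cases hx : x ∈ U <;> simp [hx]
    rw [this, lintegral_indicator hU.measurableSet]
    simp [mul_comm]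

theorem IsTauProd.unique {X Y : Type*} [TopologicalSpace X] [TopologicalSpace Y]
    {μ : BorelMeasure X} {ν : BorelMeasure Y} {l l' : BorelMeasure (X × Y)}
    (h : IsTauProd μ ν l) (h' : IsTauProd μ ν l') : l = l' := by
  let _ : MeasurableSpace (X × Y) := borel (X × Y)
  have : IsProbabilityMeasure l := h.1.1
  have : IsProbabilityMeasure l' := h'.1.1
  have hopen : ∀ W : Set (X × Y), IsOpen W → MeasurableSet W := fun W hW =>
    MeasurableSpace.measurableSet_generateFrom hW
  let R : Set (Set (X × Y)) := {W | ∃ U V, IsOpen U ∧ IsOpen V ∧ W = U ×ˢ V}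
  have hR : IsPiSystem R := by
    rintro _ ⟨U, V, hU, hV, rfl⟩ _ ⟨U', V', hU', hV', rfl⟩ _
    exact ⟨_, _, hU.inter hU', hV.inter hV', prod_inter_prod⟩
  have hle : MeasurableSpace.generateFrom R ≤ borel (X × Y) := by
    refine MeasurableSpace.generateFrom_le ?_
    rintro _ ⟨U, V, hU, hV, rfl⟩
    exact hopen _ (hU.prod hV)
  have hgen : ∀ W, MeasurableSet[MeasurableSpace.generateFrom R] W → l W = l' W := by
    intro W hW
    refine ext_on_measurableSpace_of_generate_finite (borel (X × Y)) R ?_ hle rfl hR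
      (by simp) hW
    rintro _ ⟨U, V, hU, hV, rfl⟩
    rw [h.2 U V hU hV, h'.2 U V hU hV]
  refine ext_of_generate_finite {W | IsOpen W} rfl isPiSystem_isOpen (fun W hW => ?_) (by simp)
  let 𝒢 : Set (Set (X × Y)) :=
    {O | IsOpen O ∧ O ⊆ W ∧ MeasurableSet[MeasurableSpace.generateFrom R] O}
  have hun : ⋃₀ 𝒢 = W := by
    refine subset_antisymm (sUnion_subset fun O hO => hO.2.1) ?_
    rintro ⟨x, y⟩ hp
    obtain ⟨U, V, hU, hV, hx, hy, hs⟩ := isOpen_prod_iff.1 hW x y hp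
    exact ⟨U ×ˢ V, ⟨hU.prod hV, hs,
      MeasurableSpace.measurableSet_generateFrom ⟨U, V, hU, hV, rfl⟩⟩, hx, hy⟩
  have hne : 𝒢.Nonempty := ⟨∅, isOpen_empty, empty_subset _,
    @MeasurableSet.empty _ (MeasurableSpace.generateFrom R)⟩
  have hdir : DirectedOn (· ⊆ ·) 𝒢 := fun A hA B hB =>
    ⟨A ∪ B, ⟨hA.1.union hB.1, union_subset hA.2.1 hB.2.1, @MeasurableSet.union _ (MeasurableSpace.generateFrom R) _ _ hA.2.2 hB.2.2⟩,
      subset_union_left, subset_union_right⟩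
  rw [← hun, h.1.2 𝒢 hne hdir fun O hO => hO.1, h'.1.2 𝒢 hne hdir fun O hO => hO.1]
  exact iSup_congr fun O => iSup_congr fun hO => hgen O hO.2.2

/-- The `τ`-additive product `μ × ν`, the unique measure with the property `IsTauProd μ ν`. -/
noncomputable def tauProd {X Y : Type*} [TopologicalSpace X] [TopologicalSpace Y]
    (μ : MTau X) (ν : MTau Y) : BorelMeasure (X × Y) :=
  (exists_isTauProd μ.2 ν.2).choose

theorem isTauProd_tauProd {X Y : Type*} [TopologicalSpace X] [TopologicalSpace Y]
    (μ : MTau X) (ν : MTau Y) : IsTauProd (μ : BorelMeasure X) (ν : BorelMeasure Y) (tauProd μ ν) :=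
  (exists_isTauProd μ.2 ν.2).choose_spec

/-- The convolution `μ ∗ ν`, given by `(μ ∗ ν)(E) = (μ × ν) {(g, x) | g • x ∈ E}` on Borel sets. -/
noncomputable def tauConv {G X : Type*} [TopologicalSpace G] [TopologicalSpace X] [SMul G X]
    (μ : MTau G) (ν : MTau X) : BorelMeasure X :=
  @Measure.map (G × X) X (borel (G × X)) (borel X) (fun p => p.1 • p.2) (tauProd μ ν)

/-! The Borel σ-algebra of a product may exceed the product σ-algebra, so the usual Fubini theorem
does not apply to `tauProd μ ν`. What survives is disintegration: the measure of a Borel set `W` is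
the integral of the measures of its sections, in either order (`tauProd_apply`,
`tauProd_apply_symm`). For one order, the measure defined by section integrals is a τ-additive
product, and such a product is unique; the other order follows by swapping the factors.

Taking `W` to be the preimage of `E` under the action shows that `μ * ν` is both the `μ`-mixture of
the images of `ν` under `x ↦ g • x` and the `ν`-mixture of the images of `μ` under `g ↦ g • x`.
Integrating `f` against a mixture of image measures then gives each iterated integral, with no joint
measurability needed. -/

/-! ### Integration against mixtures of image measures -/

/-- Fubini's theorem for a mixture `ρ`, over `x` distributed as `μ`, of the images of `ν` under
the maps `φ x`. -/
theorem fubini_of_forall_lintegral_preimage {X Y Z : Type*} {mX : MeasurableSpace X}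
    {mY : MeasurableSpace Y} {mZ : MeasurableSpace Z} {μ : Measure X} {ν : Measure Y}
    {ρ : Measure Z} {φ : X → Y → Z} (hφ : ∀ x, Measurable (φ x))
    (hmeas : ∀ E, MeasurableSet E → Measurable fun x => ν (φ x ⁻¹' E))
    (hρ : ∀ E, MeasurableSet E → ρ E = ∫⁻ x, ν (φ x ⁻¹' E) ∂μ) {f : Z → ℝ}
    (hf : Integrable f ρ) :
    (∀ᵐ x ∂μ, Integrable (fun y => f (φ x y)) ν) ∧
    Integrable (fun x => ∫ y, f (φ x y) ∂ν) μ ∧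
    ∫ z, f z ∂ρ = ∫ x, ∫ y, f (φ x y) ∂ν ∂μ := by
  have hκ : Measurable fun x => ν.map (φ x) := by
    refine Measure.measurable_of_measurable_coe _ fun E hE => ?_
    simp_rw [Measure.map_apply (hφ _) hE]
    exact hmeas E hE
  let κ : ProbabilityTheory.Kernel X Z := ⟨fun x => ν.map (φ x), hκ⟩
  -- A measure is a kernel from a one-point space, so the mixture becomes a composition of kernels,
  -- for which Bochner integrals are available.
  have hρκ : ρ = (κ.comp (ProbabilityTheory.Kernel.const Unit μ)) () := by
    refine Measure.ext fun E hE => ?_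
    rw [ProbabilityTheory.Kernel.comp_apply' _ _ _ hE, ProbabilityTheory.Kernel.const_apply, hρ E hE]
    exact lintegral_congr fun x => (Measure.map_apply (hφ x) hE).symm
  rw [hρκ] at hf ⊢
  -- A `ρ`-null set is null for `μ`-almost every image measure, so a.e. measurability of `f` passes
  -- to almost every one of them, and the change of variables below holds only for those `x`.
  have hae : ∀ᵐ x ∂μ, AEStronglyMeasurable f (ν.map (φ x)) := hf.1.comp
  have hcongr : (fun x => ∫ z, f z ∂(ν.map (φ x))) =ᵐ[μ] fun x => ∫ y, f (φ x y) ∂ν := by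
    filter_upwards [hae] with x hx
    exact integral_map (hφ x).aemeasurable hx
  have hint : Integrable (fun x => ∫ z, f z ∂(ν.map (φ x))) μ := hf.integral_comp
  refine ⟨?_, hint.congr hcongr, ?_⟩
  · have h : ∀ᵐ x ∂μ, Integrable f (ν.map (φ x)) := hf.ae_of_comp
    filter_upwards [h] with x hx
    exact hx.comp_measurable (hφ x)
  · rw [ProbabilityTheory.Kernel.integral_comp hf]
    exact integral_congr_ae hcongr

/-! ### The τ-additive product as an integral of sections, in both orders -/

theorem TauAdditive.map {X Y : Type*} [TopologicalSpace X] [TopologicalSpace Y]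
    {μ : BorelMeasure X} (hμ : TauAdditive μ) {φ : X → Y} (hφ : Continuous φ) :
    TauAdditive (@Measure.map X Y (borel X) (borel Y) φ μ) := by
  let _ : MeasurableSpace X := borel X
  have : BorelSpace X := ⟨rfl⟩
  let _ : MeasurableSpace Y := borel Y
  have : BorelSpace Y := ⟨rfl⟩
  intro 𝒢 hne hdir ho
  have key := hμ (preimage φ '' 𝒢) (hne.image _)
    (by
      rintro _ ⟨U, hU, rfl⟩ _ ⟨V, hV, rfl⟩
      obtain ⟨W, hW, hUW, hVW⟩ := hdir U hU V hV
      exact ⟨_, mem_image_of_mem _ hW, preimage_mono hUW, preimage_mono hVW⟩)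
    (by
      rintro _ ⟨U, hU, rfl⟩
      exact (ho U hU).preimage hφ)
  rw [iSup_image, sUnion_image, ← preimage_sUnion] at key
  rw [Measure.map_apply hφ.measurable (isOpen_sUnion ho).measurableSet, key]
  exact iSup_congr fun U => iSup_congr fun hU =>
    (Measure.map_apply hφ.measurable (ho U hU).measurableSet).symm

/-- A Borel measure on a product whose values are the integrals of the measures of the sections
is the `τ`-additive product. -/
theorem isTauProd_of_forall_lintegral_section {X Y : Type*} [TopologicalSpace X]
    [TopologicalSpace Y] {μ : BorelMeasure X} {ν : BorelMeasure Y} (hμ : μ ∈ MTau X)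
    (hν : ν ∈ MTau Y) {l : BorelMeasure (X × Y)}
    (hl : ∀ W, MeasurableSet[borel (X × Y)] W → l W = ∫⁻ x, ν (Prod.mk x ⁻¹' W) ∂μ) :
    IsTauProd μ ν l := by
  let _ : MeasurableSpace X := borel X
  have : BorelSpace X := ⟨rfl⟩
  have : IsProbabilityMeasure μ := hμ.1
  have : IsProbabilityMeasure ν := hν.1
  have hopen : ∀ W : Set (X × Y), IsOpen W → MeasurableSet[borel (X × Y)] W := fun W hW =>
    MeasurableSpace.measurableSet_generateFrom hW
  refine ⟨⟨⟨?_⟩, ?_⟩, ?_⟩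
  · rw [hl _ (hopen _ isOpen_univ)]
    simp
  · intro 𝒢 hne hdir ho
    refine le_antisymm ?_ (iSup₂_le fun U hU => measure_mono (subset_sUnion_of_mem hU))
    have : Nonempty 𝒢 := hne.to_subtype
    have : IsDirected 𝒢 (· ≤ ·) := ⟨fun a b => by
      obtain ⟨c, hc, hac, hbc⟩ := hdir a a.2 b b.2
      exact ⟨⟨c, hc⟩, hac, hbc⟩⟩
    have hsec : ∀ x, ν (Prod.mk x ⁻¹' ⋃₀ 𝒢) = ⨆ W : 𝒢, ν (Prod.mk x ⁻¹' (W : Set (X × Y))) := by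
      intro x
      have := hν.2 (range fun W : 𝒢 => Prod.mk x ⁻¹' (W : Set (X × Y))) (range_nonempty _)
        (by
          rintro _ ⟨i, rfl⟩ _ ⟨j, rfl⟩
          obtain ⟨k, hik, hjk⟩ := exists_ge_ge i j
          exact ⟨_, ⟨k, rfl⟩, preimage_mono hik, preimage_mono hjk⟩)
        (by
          rintro _ ⟨i, rfl⟩
          exact (ho i i.2).preimage (by fun_prop))
      rw [iSup_range] at this
      rw [← this]
      congr 1
      ext y
      simp
    rw [hl _ (hopen _ (isOpen_sUnion ho))]
    simp_rw [hsec]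
    -- τ-additivity of `ν` turned each section into a directed supremum, lower semicontinuous in
    -- `x`; that of `μ` now moves the supremum outside the integral.
    refine (lintegral_le_iSup_of_directed hμ (fun (W : 𝒢) x => ν (Prod.mk x ⁻¹' (W : Set (X × Y))))
      (fun i j hij x => measure_mono (preimage_mono hij))
      fun i => hν.2.lowerSemicontinuous_section (ho i i.2)).trans ?_
    refine iSup_le fun W => ?_
    rw [← hl _ (hopen _ (ho W W.2))]
    exact le_iSup₂ (f := fun U (_ : U ∈ 𝒢) => l U) W.1 W.2
  · intro U V hU hV
    rw [hl _ (hopen _ (hU.prod hV))]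
    have : (fun x => ν (Prod.mk x ⁻¹' (U ×ˢ V))) = U.indicator fun _ => ν V := by
      funext x
      by_cases hx : x ∈ U <;> simp [hx]
    rw [this, lintegral_indicator hU.measurableSet]
    simp [mul_comm]

/-- The mixture over `x` of the images of `ν` under `y ↦ (x, y)` has these values, so it is a
τ-additive product and uniqueness identifies it with `tauProd μ ν`. -/
theorem tauProd_apply {X Y : Type*} [TopologicalSpace X] [TopologicalSpace Y] (μ : MTau X)
    (ν : MTau Y) {W : Set (X × Y)} (hW : MeasurableSet[borel (X × Y)] W) :
    tauProd μ ν W = ∫⁻ x, (ν : BorelMeasure Y) (Prod.mk x ⁻¹' W) ∂(μ : BorelMeasure X) := by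
  let _ : MeasurableSpace X := borel X
  let _ : MeasurableSpace Y := borel Y
  let _ : MeasurableSpace (X × Y) := borel (X × Y)
  have hmk : ∀ x : X, Measurable (Prod.mk x : Y → X × Y) := fun x =>
    Continuous.borel_measurable (by fun_prop)
  let κ : X → Measure (X × Y) := fun x => Measure.map (Prod.mk x) (ν : BorelMeasure Y)
  have hκ : ∀ x W, MeasurableSet W → κ x W = (ν : BorelMeasure Y) (Prod.mk x ⁻¹' W) :=
    fun x W hW => Measure.map_apply (hmk x) hW
  have hκm : Measurable κ := by
    refine Measure.measurable_of_measurable_coe _ fun W hW => ?_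
    simp_rw [hκ _ W hW]
    exact measurable_section_of_mem_MTau ν.2 hW
  have hl : ∀ W, MeasurableSet W → Measure.bind (μ : BorelMeasure X) κ W =
      ∫⁻ x, (ν : BorelMeasure Y) (Prod.mk x ⁻¹' W) ∂(μ : BorelMeasure X) := by
    intro W hW
    rw [Measure.bind_apply hW hκm.aemeasurable]
    simp_rw [hκ _ W hW]
  rw [(isTauProd_tauProd μ ν).unique (isTauProd_of_forall_lintegral_section μ.2 ν.2 hl), hl W hW]

/-- Swapping is continuous, so it preserves τ-additivity, and it exchanges the sides of open
rectangles; uniqueness does the rest. -/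
theorem map_swap_tauProd {X Y : Type*} [TopologicalSpace X] [TopologicalSpace Y] (μ : MTau X)
    (ν : MTau Y) :
    @Measure.map (X × Y) (Y × X) (borel _) (borel _) Prod.swap (tauProd μ ν) = tauProd ν μ := by
  let _ : MeasurableSpace (X × Y) := borel (X × Y)
  let _ : MeasurableSpace (Y × X) := borel (Y × X)
  have hs : Measurable (Prod.swap : X × Y → Y × X) := continuous_swap.borel_measurable
  have h := isTauProd_tauProd μ ν
  have : IsProbabilityMeasure (tauProd μ ν) := h.1.1
  refine IsTauProd.unique ⟨⟨Measure.isProbabilityMeasure_map hs.aemeasurable,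
    h.1.2.map continuous_swap⟩, fun U V hU hV => ?_⟩ (isTauProd_tauProd ν μ)
  rw [Measure.map_apply hs (MeasurableSpace.measurableSet_generateFrom (hU.prod hV)),
    preimage_swap_prod, h.2 V U hV hU, mul_comm]

theorem tauProd_apply_symm {X Y : Type*} [TopologicalSpace X] [TopologicalSpace Y] (μ : MTau X)
    (ν : MTau Y) {W : Set (X × Y)} (hW : MeasurableSet[borel (X × Y)] W) :
    tauProd μ ν W =
      ∫⁻ y, (μ : BorelMeasure X) ((fun x => (x, y)) ⁻¹' W) ∂(ν : BorelMeasure Y) := by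
  let _ : MeasurableSpace (X × Y) := borel (X × Y)
  let _ : MeasurableSpace (Y × X) := borel (Y × X)
  have hs : Measurable (Prod.swap : Y × X → X × Y) := continuous_swap.borel_measurable
  rw [← map_swap_tauProd ν μ, Measure.map_apply hs hW, tauProd_apply ν μ (hs hW)]
  rfl

/-! ### Fubini's theorem for the convolution -/

theorem mainTheorem6 {G X : Type*} [Group G] [TopologicalSpace G] [IsTopologicalGroup G]
    [TopologicalSpace X] [RegularSpace X] [MulAction G X] [ContinuousSMul G X]
    (μ : MTau G) (ν : MTau X) (f : X → ℝ) (hf : Integrable f (tauConv μ ν)) :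
    Integrable (fun p : G × X => f (p.1 • p.2)) (tauProd μ ν) ∧
    (∀ᵐ x ∂(ν : BorelMeasure X), Integrable (fun g : G => f (g • x)) (μ : BorelMeasure G)) ∧
    Integrable (fun x : X => ∫ g : G, f (g • x) ∂(μ : BorelMeasure G)) (ν : BorelMeasure X) ∧
    (∀ᵐ g ∂(μ : BorelMeasure G), Integrable (fun x : X => f (g • x)) (ν : BorelMeasure X)) ∧
    Integrable (fun g : G => ∫ x : X, f (g • x) ∂(ν : BorelMeasure X)) (μ : BorelMeasure G) ∧
    ∫ x, f x ∂(tauConv μ ν) = ∫ p : G × X, f (p.1 • p.2) ∂(tauProd μ ν) ∧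
    ∫ p : G × X, f (p.1 • p.2) ∂(tauProd μ ν) =
      ∫ x : X, ∫ g : G, f (g • x) ∂(μ : BorelMeasure G) ∂(ν : BorelMeasure X) ∧
    ∫ x : X, ∫ g : G, f (g • x) ∂(μ : BorelMeasure G) ∂(ν : BorelMeasure X) =
      ∫ g : G, ∫ x : X, f (g • x) ∂(ν : BorelMeasure X) ∂(μ : BorelMeasure G) := by
  let _ : MeasurableSpace G := borel G
  have : BorelSpace G := ⟨rfl⟩
  let _ : MeasurableSpace X := borel X
  have : BorelSpace X := ⟨rfl⟩
  let _ : MeasurableSpace (G × X) := borel (G × X)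
  let _ : MeasurableSpace (X × G) := borel (X × G)
  have hc : Continuous fun p : G × X => p.1 • p.2 := continuous_smul
  have hm : Measurable fun p : G × X => p.1 • p.2 := hc.borel_measurable
  have hmap : tauConv μ ν = Measure.map (fun p : G × X => p.1 • p.2) (tauProd μ ν) := rfl
  have hpre : ∀ E : Set X, MeasurableSet E →
      tauConv μ ν E = tauProd μ ν ((fun p : G × X => p.1 • p.2) ⁻¹' E) := fun E hE =>
    Measure.map_apply hm hE
  -- By continuity of the action, the preimage of a Borel set `E` is Borel in `G × X`; its section
  -- at `g` is the preimage of `E` under `x ↦ g • x`.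
  obtain ⟨h₁, h₂, h₃⟩ := fubini_of_forall_lintegral_preimage (μ := (μ : BorelMeasure G))
    (ν := (ν : BorelMeasure X)) (ρ := tauConv μ ν) (φ := fun g x => g • x)
    (fun g => (continuous_const_smul g).measurable)
    (fun E hE => measurable_section_of_mem_MTau ν.2 (hm hE))
    (fun E hE => (hpre E hE).trans (tauProd_apply μ ν (hm hE))) hf
  have hm' : Measurable fun p : X × G => p.2 • p.1 :=
    (hc.comp continuous_swap).borel_measurable
  -- The same measure `tauConv μ ν`, now read as a mixture over `x` of the images of `μ` under the
  -- orbit maps `g ↦ g • x`.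
  obtain ⟨h₁', h₂', h₃'⟩ := fubini_of_forall_lintegral_preimage (μ := (ν : BorelMeasure X))
    (ν := (μ : BorelMeasure G)) (ρ := tauConv μ ν) (φ := fun x g => g • x)
    (fun x => (continuous_id.smul continuous_const).measurable)
    (fun E hE => measurable_section_of_mem_MTau μ.2 (hm' hE))
    (fun E hE => (hpre E hE).trans (tauProd_apply_symm μ ν (hm hE))) hf
  have h₄ : ∫ x, f x ∂(tauConv μ ν) = ∫ p : G × X, f (p.1 • p.2) ∂(tauProd μ ν) := by
    rw [hmap] at hf ⊢
    exact integral_map hm.aemeasurable hf.1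
  rw [hmap] at hf
  exact ⟨hf.comp_measurable hm, h₁', h₂', h₁, h₂, h₄, h₄.symm.trans h₃', h₃'.symm.trans h₃⟩
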